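/- Let $I$ and $O$ be disjoint sets of process inputs and outputs, with a distinguished input $\mathsf{rcv}\in I$ and two distinct distinguished outputs $\mathsf{snd},\mathsf{tok}\in O$. A process template $(I,O,Q,Q_0,\delta,out,A_{loc})$ has a finite state set $Q=T\,\dot\cup\,NT$ with $T=\{q : \mathsf{tok}\in out(q)\}$, where $out:Q\to 2^O$ and $\mathsf{snd}\in out(q)$ implies $q\in T$; two initial states, one in $T$ and one in $NT$; and a transition relation $\delta\subseteq Q\times 2^I\times Q$ each of whose transitions $(q,i,q')$ is of one of four kinds: $\mathsf{snd}\in out(q)$, $\mathsf{rcv}\notin i$, $q'\in NT$; or $q\in NT$, $\mathsf{rcv}\in i$, $q'\in T$; or $q,q'\in NT$, $\mathsf{rcv}\notin i$; or $q\in T$, $\mathsf{snd}\notin out(q)$, $\mathsf{rcv}\notin i$, $q'\in T$. Every $q\in NT$ has a successor for every $i\subseteq I$, and every $q\in T$ has one for every $i\subseteq I$ with $\mathsf{rcv}\notin i$. Finally $A_{loc}$ is an LTL formula over $I\cup O$ such that every infinite path of the process from an initial state that satisfies $A_{loc}$ satisfies $\mathsf G(\mathsf{tok}\to\mathsf F\,\mathsf{snd})$.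 Given process templates $A$ and $B$ over the same $I,O$, the fully asynchronous token ring $(A,B)^{(1,n)}$ has processes $A,B_1,\dots,B_n$ arranged in this cyclic order. There are no global inputs: every process has its own copy of each input in $I$. Initially $A$ is in its initial state with the token and each $B_i$ is in its initial state without the token. In each step a set $M$ (possibly empty) of processes moves, each according to the transition relation of its template and its own input, and the other processes keep their states. Either the step is internal (no process in $M$ is in a state with $\mathsf{snd}$ or has $\mathsf{rcv}$ in its input), or it passes the token: there is a process $v$ with successor $w$ in the ring, $v,w\in M$, such that $v$ is the only process in $M$ whose state has $\mathsf{snd}$ and $w$ is the only process in $M$ whose input contains $\mathsf{rcv}$. A run is an infinite sequence of triples $(s_k,in_k,M_k)$ of states, inputs and sets of moving processes. It satisfies a formula iff the sequence of letters $(Out(s_k),in_k)$ does, with the standard semantics of LTL except that, for a process $p$, the next operator $\mathsf X_p\,\varphi$ holds at position $k$ iff there is a second smallest position $i\ge k$ with $p\in M_i$ and $\varphi$ holds at $i$. In a formula local to $p$ all propositions and all next operators refer to $p$. We write $(A,B)^{(1,n)}\models\Phi$ if all infinite runs satisfy $\Phi$. **Theorem.** Let $A$ and $B$ be process templates with fairness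 conditions $A^A_{loc}$ and $A^B_{loc}$, and let $\psi$ be an LTL formula (which may use $\mathsf X$) over the propositions of a single process. Then $(1,1)$ is a cutoff for each of the following two specifications $\Phi_n$, i.e. for all $n\ge 1$ we have $(A,B)^{(1,1)}\models\Phi_1 \iff (A,B)^{(1,n)}\models\Phi_n$: 1. $\Phi_n = \big(A^A_{loc}\wedge \mathsf{GF}\,\mathsf{tok}_A\to\psi(A)\big)$, where $A^A_{loc}$ is interpreted over the propositions of the process $A$; 2. $\Phi_n = \forall i\in\{1,\dots,n\}.\ \big(A^B_{loc,i}\wedge \mathsf{GF}\,\mathsf{tok}_i\to\psi(B_i)\big)$, where $A^B_{loc,i}$ is $A^B_{loc}$ with all propositions subscripted with $i$. -/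

import Mathlib

namespace TokenRing

/-- LTL over atomic propositions `AP`; the next operator `X_v` carries a process index `v : V`. -/
inductive LTL (AP : Type*) (V : Type*) where
  | tru : LTL AP V
  | atom : AP → LTL AP V
  | neg : LTL AP V → LTL AP V
  | and : LTL AP V → LTL AP V → LTL AP V
  | untl : LTL AP V → LTL AP V → LTL AP V
  | next : V → LTL AP V → LTL AP V

namespace LTL

variable {AP AP' V V' : Type*}

/-- `φ → ψ` -/
def imp (φ ψ : LTL AP V) : LTL AP V := neg (and φ (neg ψ))

/-- `F φ` -/
def ev (φ : LTL AP V) : LTL AP V := untl tru φ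

/-- `G φ` -/
def alw (φ : LTL AP V) : LTL AP V := neg (ev (neg φ))

/-- finite conjunction -/
def conj (l : List (LTL AP V)) : LTL AP V := l.foldr and tru

/-- Renaming of propositions and process indices. -/
def rename (f : AP → AP') (g : V → V') : LTL AP V → LTL AP' V'
  | tru => tru
  | atom p => atom (f p)
  | neg φ => neg (rename f g φ)
  | and φ ψ => and (rename f g φ) (rename f g ψ)
  | untl φ ψ => untl (rename f g φ) (rename f g ψ)
  | next v φ => next (g v) (rename f g φ)

/-- `Sat w M φ k`: the suffix starting at position `k` of the infinite word `w` satisfies `φ`,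
where `M j` is the set of processes that move at position `j`.
`X_v φ` holds iff `φ` holds at the second position `i ≥ k` at which `v` moves (in particular,
there is such a position). -/
def Sat (w : ℕ → Set AP) (M : ℕ → Set V) : LTL AP V → ℕ → Prop
  | tru, _ => True
  | atom p, k => p ∈ w k
  | neg φ, k => ¬ Sat w M φ k
  | and φ ψ, k => Sat w M φ k ∧ Sat w M ψ k
  | untl φ ψ, k => ∃ l, k ≤ l ∧ Sat w M ψ l ∧ ∀ j, k ≤ j → j < l → Sat w M φ j
  | next v φ, k => ∃ j i, k ≤ j ∧ j < i ∧ v ∈ M j ∧ v ∈ M i ∧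
      (∀ l, k ≤ l → l < i → l ≠ j → v ∉ M l) ∧ Sat w M φ i

end LTL

/-- LTL formulas over the input and output variables of one process; its only process index
is the process itself. -/
abbrev LocalLTL (Ipr Opr : Type*) := LTL (Ipr ⊕ Opr) Unit

/-- The distinguished variables of the process inputs `Ipr` and outputs `Opr`, and the set
`glob` of those inputs that are global (shared by all processes of a system). -/
structure Interface (Ipr Opr : Type*) where
  rcv : Ipr
  snd : Opr
  tok : Opr
  snd_ne_tok : snd ≠ tok
  glob : Set Ipr
  rcv_local : rcv ∉ glob

/-- The letter seen in a state with outputs `o` in which the input `i` is to be read. -/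
def letter {Ipr Opr : Type*} (o : Set Opr) (i : Set Ipr) : Set (Ipr ⊕ Opr) :=
  Sum.inl '' i ∪ Sum.inr '' o

universe u v w

/-- Process templates. The states with the token are those whose outputs contain `tok`. -/
structure ProcessTemplate {Ipr : Type u} {Opr : Type v} (S : Interface Ipr Opr) where
  Q : Type w
  finite : Finite Q
  out : Q → Set Opr
  /-- the initial state with the token -/
  initT : Q
  /-- the initial state without the token -/
  initN : Q
  initT_tok : S.tok ∈ out initT
  initN_tok : S.tok ∉ out initN
  snd_tok : ∀ q, S.snd ∈ out q → S.tok ∈ out q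
  trans : Q → Set Ipr → Q → Prop
  /-- The four kinds of transitions: sending, receiving, internal without the token,
  internal with the token. -/
  trans_kind : ∀ q i q', trans q i q' →
    (S.snd ∈ out q ∧ S.rcv ∉ i ∧ S.tok ∉ out q') ∨
    (S.tok ∉ out q ∧ S.rcv ∈ i ∧ S.tok ∈ out q') ∨
    (S.tok ∉ out q ∧ S.rcv ∉ i ∧ S.tok ∉ out q') ∨
    (S.tok ∈ out q ∧ S.snd ∉ out q ∧ S.rcv ∉ i ∧ S.tok ∈ out q')
  total_N : ∀ q, S.tok ∉ out q → ∀ i, ∃ q', trans q i q'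
  total_T : ∀ q, S.tok ∈ out q → ∀ i, S.rcv ∉ i → ∃ q', trans q i q'
  /-- the fairness condition -/
  Aloc : LocalLTL Ipr Opr
  /-- On every infinite path of the process from an initial state that satisfies `Aloc`,
  whenever the process has the token, it eventually reaches a state where it sends it. -/
  releases : ∀ (q : ℕ → Q) (i : ℕ → Set Ipr), (q 0 = initT ∨ q 0 = initN) →
    (∀ k, trans (q k) (i k) (q (k + 1))) →
    LTL.Sat (fun k => letter (out (q k)) (i k)) (fun _ => Set.univ) Aloc 0 →
    ∀ k, S.tok ∈ out (q k) → ∃ l, k ≤ l ∧ S.snd ∈ out (q l)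

section System

variable {Ipr : Type u} {Opr : Type v} (S : Interface Ipr Opr)

/-- System input variables: a copy of each local input for every process, and the global
inputs. -/
abbrev SysInVar (V : Type*) := ({i : Ipr // i ∉ S.glob} × V) ⊕ {i : Ipr // i ∈ S.glob}

/-- System propositions: system input variables and a copy of each output for every process. -/
abbrev SysAP (V : Type*) := SysInVar S V ⊕ (Opr × V)

open Classical in
/-- The system input variable that process `v` reads as its input `i`. -/
noncomputable def inVar {V : Type*} (v : V) (i : Ipr) : SysInVar S V :=
  if h : i ∈ S.glob then Sum.inr ⟨i, h⟩ else Sum.inl (⟨i, h⟩, v)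

/-- The input to process `v` under a given system input. -/
def localIn {V : Type*} (inp : Set (SysInVar S V)) (v : V) : Set Ipr := {i | inVar S v i ∈ inp}

/-- The local formula `φ` with all propositions (and next operators) subscripted with `v`. -/
noncomputable def subscript {V : Type*} (v : V) (φ : LocalLTL Ipr Opr) : LTL (SysAP S V) V :=
  φ.rename (Sum.map (inVar S v) (fun o => (o, v))) (fun _ => v)

variable {S} {n : ℕ}

/-- The ring has the vertices `0, …, n` and the edges from `v` to `v + 1` (modulo `n + 1`);
the process at vertex `v` is a copy of `P v`. -/
abbrev SysState (P : Fin (n + 1) → ProcessTemplate.{u, v, w} S) := ∀ v, (P v).Q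

/-- Internal transition of the processes in `M`. -/
def InternalStep (P : Fin (n + 1) → ProcessTemplate.{u, v, w} S) (M : Set (Fin (n + 1)))
    (s : SysState P) (inp : Set (SysInVar S (Fin (n + 1)))) (s' : SysState P) : Prop :=
  (∀ v ∈ M, S.snd ∉ (P v).out (s v) ∧ S.rcv ∉ localIn S inp v) ∧
  (∀ v ∈ M, (P v).trans (s v) (localIn S inp v) (s' v)) ∧
  (∀ v, v ∉ M → s' v = s v)

/-- Transition of the processes in `M` in which some `v` passes the token to `v + 1`. -/
def TokenStep (P : Fin (n + 1) → ProcessTemplate.{u, v, w} S) (M : Set (Fin (n + 1)))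
    (s : SysState P) (inp : Set (SysInVar S (Fin (n + 1)))) (s' : SysState P) : Prop :=
  ∃ v, v ∈ M ∧ v + 1 ∈ M ∧
    S.snd ∈ (P v).out (s v) ∧ (∀ x ∈ M, x ≠ v → S.snd ∉ (P x).out (s x)) ∧
    S.rcv ∈ localIn S inp (v + 1) ∧ (∀ x ∈ M, x ≠ v + 1 → S.rcv ∉ localIn S inp x) ∧
    (∀ x ∈ M, (P x).trans (s x) (localIn S inp x) (s' x)) ∧
    (∀ x, x ∉ M → s' x = s x)

/-- Initial states: every process is in an initial state, and exactly one has the token. -/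
def IsInitial (P : Fin (n + 1) → ProcessTemplate.{u, v, w} S) (s : SysState P) : Prop :=
  (∀ v, s v = (P v).initT ∨ s v = (P v).initN) ∧ ∃! v, S.tok ∈ (P v).out (s v)

/-- An infinite sequence of states, inputs and sets of moving processes. -/
structure SysSeq (P : Fin (n + 1) → ProcessTemplate.{u, v, w} S) where
  state : ℕ → SysState P
  inp : ℕ → Set (SysInVar S (Fin (n + 1)))
  moved : ℕ → Set (Fin (n + 1))

/-- Infinite runs of the fully asynchronous token ring. -/
def IsRun (P : Fin (n + 1) → ProcessTemplate.{u, v, w} S) (x : SysSeq P) : Prop :=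
  IsInitial P (x.state 0) ∧
  ∀ k, InternalStep P (x.moved k) (x.state k) (x.inp k) (x.state (k + 1)) ∨
    TokenStep P (x.moved k) (x.state k) (x.inp k) (x.state (k + 1))

/-- The system letter at position `k` of a run: its input and outputs. -/
def SysSeq.word {P : Fin (n + 1) → ProcessTemplate.{u, v, w} S} (x : SysSeq P) (k : ℕ) :
    Set (SysAP S (Fin (n + 1))) :=
  Sum.inl '' x.inp k ∪ Sum.inr '' {p : Opr × Fin (n + 1) | p.1 ∈ (P p.2).out (x.state k p.2)}

/-- The processes of `(A,B)^(1,n)`: the `A`-process is vertex `0`, and `B_1, …, B_n` are the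
vertices `1, …, n`. -/
def ring (A B : ProcessTemplate.{u, v, w} S) (n : ℕ) :
    Fin (n + 1) → ProcessTemplate.{u, v, w} S :=
  Fin.cases A (fun _ => B)

/-- `(A,B)^(1,n) ⊨ Φ`, where initially the process `A` has the token. -/
def Models (A B : ProcessTemplate.{u, v, w} S) (n : ℕ)
    (Φ : LTL (SysAP S (Fin (n + 1))) (Fin (n + 1))) : Prop :=
  ∀ x : SysSeq (ring A B n), IsRun (ring A B n) x →
    S.tok ∈ (ring A B n 0).out (x.state 0 0) → LTL.Sat x.word x.moved Φ 0

/-- `(1,c)` is a cutoff for the specification whose instance for `n` `B`-processes is `Φ n`. -/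
def IsCutoff (A B : ProcessTemplate.{u, v, w} S)
    (Φ : ∀ n : ℕ, LTL (SysAP S (Fin (n + 1))) (Fin (n + 1))) (c : ℕ) : Prop :=
  ∀ n, c ≤ n → (Models A B c (Φ c) ↔ Models A B n (Φ n))

variable (S)

/-- The local formula `P.Aloc ∧ G F tok → ψ`. -/
def fairSpec (P : ProcessTemplate.{u, v, w} S) (ψ : LocalLTL Ipr Opr) : LocalLTL Ipr Opr :=
  LTL.imp (LTL.and P.Aloc (LTL.alw (LTL.ev (LTL.atom (Sum.inr S.tok))))) ψ

/-- `A_loc ∧ G F tok_A → ψ(A)` -/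
noncomputable def specA (A : ProcessTemplate.{u, v, w} S) (ψ : LocalLTL Ipr Opr) (n : ℕ) :
    LTL (SysAP S (Fin (n + 1))) (Fin (n + 1)) :=
  subscript S 0 (fairSpec S A ψ)

/-- `∀ i ∈ {B_1, …, B_n}. B_loc,i ∧ G F tok_i → ψ(B_i)` -/
noncomputable def specB (B : ProcessTemplate.{u, v, w} S) (ψ : LocalLTL Ipr Opr) (n : ℕ) :
    LTL (SysAP S (Fin (n + 1))) (Fin (n + 1)) :=
  LTL.conj ((List.finRange n).map fun i => subscript S i.succ (fairSpec S B ψ))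

end System

end TokenRing

namespace TokenRing

open Relation

universe u v w

/-! ### Local formulas -/

namespace LTL

variable {AP V : Type*}

/-! A local formula cannot see how long its process idles: repeating positions without a move of the
process changes nothing (`LTL.sat_comp_clock`). So a run can be cut into one `Track` per process,
and tracks can be replayed on separate clocks in a ring of another size. As no input is shared, the
token is the only coupling: a sending tick must coincide with the receiving tick of the successor,
and all other ticks are free. `exists_run` turns clocks obeying this into a run, so only schedules
remain to be found.

From size two to a large ring (`exists_schedule_large`), all `B`-processes replay the same track.
While `A` waits just before its reception, each `B` in turn lives through its whole period with the
token and hands it on.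

From a large ring to size two (`exists_schedule_two`), only `A` and one `B`-process are kept, and
they hand the token directly to each other. This works because on the ring the visits to two
vertices alternate. The token could get stuck elsewhere after the observed process has sent it, but
then `G F tok` fails and the specification holds vacuously (`Track.sat_fairSpec`). -/

theorem sat_imp {w : ℕ → Set AP} {M : ℕ → Set V} {φ ψ : LTL AP V} {k : ℕ} :
    Sat w M (imp φ ψ) k ↔ (Sat w M φ k → Sat w M ψ k) := by
  simp [imp, Sat]

theorem sat_ev {w : ℕ → Set AP} {M : ℕ → Set V} {φ : LTL AP V} {k : ℕ} :
    Sat w M (ev φ) k ↔ ∃ l, k ≤ l ∧ Sat w M φ l := by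
  simp [ev, Sat]

theorem sat_alw {w : ℕ → Set AP} {M : ℕ → Set V} {φ : LTL AP V} {k : ℕ} :
    Sat w M (alw φ) k ↔ ∀ l, k ≤ l → Sat w M φ l := by
  simp [alw, sat_ev, Sat]

theorem sat_conj {w : ℕ → Set AP} {M : ℕ → Set V} {l : List (LTL AP V)} {k : ℕ} :
    Sat w M (conj l) k ↔ ∀ φ ∈ l, Sat w M φ k := by
  induction l with
  | nil => simp [conj, Sat]
  | cons φ l ih =>
    have : conj (φ :: l) = and φ (conj l) := rfl
    simp [this, Sat, ih]

/-- A clock `c` that advances by at most one at each position visits every later time, and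
leaves it, if it is unbounded. -/
theorem exists_leave {c : ℕ → ℕ} (hc : ∀ j, c (j + 1) = c j ∨ c (j + 1) = c j + 1)
    (hub : ∀ t, ∃ j, t ≤ c j) {j t : ℕ} (ht : c j ≤ t) :
    ∃ i, j ≤ i ∧ c i = t ∧ c (i + 1) = t + 1 := by
  have hmono : Monotone c := monotone_nat_of_le_succ fun j => by have := hc j; omega
  have hex : ∃ i, t < c i := (hub (t + 1)).imp fun i hi => hi
  classical
  have h1 := Nat.find_spec hex
  have hj : j < Nat.find hex := by
    by_contra h
    have := hmono (not_lt.mp h)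
    omega
  obtain ⟨i, hi⟩ : ∃ i, Nat.find hex = i + 1 := ⟨Nat.find hex - 1, by omega⟩
  have h2 : ¬ t < c i := Nat.find_min hex (by omega)
  rw [hi] at h1
  have := hc i
  exact ⟨i, by omega, by omega, by omega⟩

/-- Formulas do not distinguish a word from the same word seen through a clock that
advances by at most one at each position. -/
theorem sat_comp_clock {w : ℕ → Set AP} {M M' : ℕ → Set V} {c : ℕ → ℕ}
    (hc : ∀ j, c (j + 1) = c j ∨ c (j + 1) = c j + 1) (hub : ∀ t, ∃ j, t ≤ c j)
    (hM : ∀ j v, v ∈ M' j ↔ c (j + 1) ≠ c j ∧ v ∈ M (c j)) (φ : LTL AP V) (k : ℕ) :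
    Sat (fun j => w (c j)) M' φ k ↔ Sat w M φ (c k) := by
  have hmono : Monotone c := monotone_nat_of_le_succ fun j => by have := hc j; omega
  have hlt : ∀ {i j}, c i < c j → i < j := fun h => hmono.reflect_lt h
  induction φ generalizing k with
  | tru => simp [Sat]
  | atom p => simp [Sat]
  | neg φ ih => simp [Sat, ih]
  | and φ ψ ih₁ ih₂ => simp [Sat, ih₁, ih₂]
  | untl φ ψ ih₁ ih₂ =>
    simp only [Sat, ih₁, ih₂]
    constructor
    · rintro ⟨l, hkl, hl, h⟩
      refine ⟨c l, hmono hkl, hl, fun t ht htl => ?_⟩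
      obtain ⟨i, hi, rfl, -⟩ := exists_leave hc hub ht
      exact h i hi (hlt htl)
    · rintro ⟨l, hkl, hl, h⟩
      have hex : ∃ i, k ≤ i ∧ c i = l := (exists_leave hc hub hkl).imp fun i hi => ⟨hi.1, hi.2.1⟩
      classical
      obtain ⟨h1, h2⟩ := Nat.find_spec hex
      -- At the first position showing time `l`, all earlier ones from `k` on show smaller times.
      refine ⟨Nat.find hex, h1, by rwa [h2], fun i hki hi => h _ (hmono hki) ?_⟩
      have := hmono hi.le
      exact lt_of_le_of_ne (by omega) fun hil => Nat.find_min hex hi ⟨hki, hil⟩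
  | next v φ ih =>
    simp only [Sat, ih, hM]
    constructor
    · rintro ⟨j, i, hkj, hji, ⟨hj, hvj⟩, ⟨hi, hvi⟩, h, hφ⟩
      have hji' : c (j + 1) ≤ c i := hmono hji
      have := hc j
      refine ⟨c j, c i, hmono hkj, by omega, hvj, hvi, fun t ht hti htj hvt => ?_, hφ⟩
      obtain ⟨l, hl, rfl, hl'⟩ := exists_leave hc hub ht
      exact h l hl (hlt hti) (fun e => htj (by rw [e])) ⟨by omega, hvt⟩
    · rintro ⟨j, i, hkj, hji, hvj, hvi, h, hφ⟩
      -- By `hM` a move counts only at the last position showing a given time, so the witnesses are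
      -- the positions where the clock leaves `j` and `i`.
      obtain ⟨j', hj', rfl, hj''⟩ := exists_leave hc hub hkj
      obtain ⟨i', hi', rfl, hi''⟩ := exists_leave hc hub (hkj.trans hji.le)
      refine ⟨j', i', hj', hlt hji, ⟨by omega, hvj⟩, ⟨by omega, hvi⟩, ?_, hφ⟩
      rintro l hkl hli hlj ⟨hl, hvl⟩
      have h1 := hc l
      have h2 : c (l + 1) ≤ c i' := hmono hli
      refine h (c l) (hmono hkl) (by omega) (fun e => ?_) hvl
      rcases lt_or_gt_of_ne hlj with h3 | h3
      · have : c (l + 1) ≤ c j' := hmono h3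
        omega
      · have : c (j' + 1) ≤ c l := hmono h3
        omega

end LTL

/-! ### Concatenation of finite paths -/

theorem exists_path_of_transGen {α : Type*} {r : α → α → Prop} {a b : α} (h : TransGen r a b) :
    ∃ (m : ℕ) (g : ℕ → α), g 0 = a ∧ g (m + 1) = b ∧ ∀ j ≤ m, r (g j) (g (j + 1)) := by
  induction h using TransGen.head_induction_on with
  | single h =>
    rename_i a
    refine ⟨0, fun j => if j = 0 then a else b, by simp, by simp, fun j hj => ?_⟩
    obtain rfl : j = 0 := by omega
    simpa using h
  | head h _ ih =>
    rename_i a _ _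
    obtain ⟨m, g, h0, hm, hg⟩ := ih
    refine ⟨m + 1, fun j => Nat.rec a (fun i _ => g i) j, rfl, hm, fun j hj => ?_⟩
    cases j with
    | zero => simpa [h0] using h
    | succ j => exact hg j (by omega)

theorem exists_seq_of_transGen {α : Type*} {r : α → α → Prop} {C : ℕ → α}
    (hC : ∀ k, TransGen r (C k) (C (k + 1))) :
    ∃ f : ℕ → α, f 0 = C 0 ∧ (∀ j, r (f j) (f (j + 1))) ∧ ∀ k, ∃ j, f j = C k := by
  choose m g h0 hm hg using fun k => exists_path_of_transGen (hC k)
  -- Pairs of segment and offset; the end of a segment is identified with offset `0` of the next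
  -- one.
  let next : ℕ × ℕ → ℕ × ℕ := fun x => if x.2 < m x.1 then (x.1, x.2 + 1) else (x.1 + 1, 0)
  let pos : ℕ → ℕ × ℕ := fun i => next^[i] (0, 0)
  have hpos : ∀ i, pos (i + 1) = next (pos i) := fun i => Function.iterate_succ_apply' _ _ _
  have hle : ∀ i, (pos i).2 ≤ m (pos i).1 := by
    intro i
    induction i with
    | zero => simp [pos]
    | succ i ih =>
      rw [hpos]
      simp only [next]
      split_ifs with h
      · exact h
      · exact Nat.zero_le _
  refine ⟨fun i => g (pos i).1 (pos i).2, h0 0, fun i => ?_, fun k => ?_⟩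
  · have h1 := hg _ _ (hle i)
    have h2 := hle i
    simp only [hpos, next]
    split_ifs with h
    · exact h1
    · have h3 : (pos i).2 = m (pos i).1 := by omega
      rw [h0, ← hm]
      rwa [h3] at h1 ⊢
  · suffices h : ∀ k, ∃ i, pos i = (k, 0) by
      obtain ⟨i, hi⟩ := h k
      exact ⟨i, by simp [hi, h0]⟩
    intro k
    induction k with
    | zero => exact ⟨0, rfl⟩
    | succ k ih =>
      obtain ⟨i, hi⟩ := ih
      have hrun : ∀ l ≤ m k, pos (i + l) = (k, l) := by
        intro l
        induction l with
        | zero => exact fun _ => hi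
        | succ l ihl =>
          intro hl
          have hl' : l < m k := by omega
          rw [← add_assoc, hpos, ihl hl'.le]
          simp [next, hl']
      refine ⟨i + m k + 1, ?_⟩
      rw [hpos, hrun _ le_rfl]
      simp [next]

/-! ### Clock vectors -/

/-- Each process `v` of a ring has its own clock, and `τ v t` says that it has the token at its
local time `t`. Either one clock advances without a change of the token, or `v` passes the
token to `v + 1`. -/
inductive ClockStep {n : ℕ} (τ : Fin (n + 1) → ℕ → Prop) (c c' : Fin (n + 1) → ℕ) : Prop
  | silent (v : Fin (n + 1)) (hτ : τ v (c v) ↔ τ v (c v + 1)) (hv : c' v = c v + 1)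
      (ho : ∀ x, x ≠ v → c' x = c x)
  | pass (v : Fin (n + 1)) (hs : τ v (c v)) (hs' : ¬ τ v (c v + 1))
      (hr : ¬ τ (v + 1) (c (v + 1))) (hr' : τ (v + 1) (c (v + 1) + 1))
      (hv : c' v = c v + 1) (hw : c' (v + 1) = c (v + 1) + 1)
      (ho : ∀ x, x ≠ v → x ≠ v + 1 → c' x = c x)

/-- Ticks that do not change possession of the token need no partner, so they can be made one at a
time; induction on the number of ticks left. -/
theorem ClockStep.advance {n : ℕ} {τ : Fin (n + 1) → ℕ → Prop} {c c' : Fin (n + 1) → ℕ}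
    (hle : ∀ v, c v ≤ c' v)
    (hτ : ∀ v t, c v ≤ t → t < c' v → (τ v t ↔ τ v (t + 1))) :
    ReflTransGen (ClockStep τ) c c' := by
  induction hd : ∑ v, (c' v - c v) generalizing c with
  | zero =>
    have : c = c' := funext fun v => by
      have := (Finset.sum_eq_zero_iff.mp hd) v (Finset.mem_univ v)
      have := hle v
      omega
    rw [this]
  | succ d ih =>
    obtain ⟨v, -, hv⟩ : ∃ v ∈ Finset.univ, c' v - c v ≠ 0 :=
      Finset.exists_ne_zero_of_sum_ne_zero (by omega)
    have hstep : ClockStep τ c (Function.update c v (c v + 1)) :=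
      .silent v (hτ v _ le_rfl (by omega)) (by simp) fun x hx => by simp [hx]
    refine ReflTransGen.head hstep (ih (fun x => ?_) (fun x t hx => hτ x t ?_) ?_)
    · by_cases hx : x = v
      · subst hx; simp; omega
      · simp [hx, hle]
    · by_cases h : x = v
      · subst h; simp at hx; omega
      · simpa [h] using hx
    · have h1 := Finset.add_sum_erase Finset.univ (fun x => c' x - c x) (Finset.mem_univ v)
      have h2 := Finset.add_sum_erase Finset.univ
        (fun x => c' x - Function.update c v (c v + 1) x) (Finset.mem_univ v)
      have h3 : ∑ x ∈ Finset.univ.erase v, (c' x - Function.update c v (c v + 1) x)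
          = ∑ x ∈ Finset.univ.erase v, (c' x - c x) :=
        Finset.sum_congr rfl fun x hx => by simp [Finset.ne_of_mem_erase hx]
      simp only [Function.update_self] at h2
      omega

/-- An infinite sequence of clock steps in which the clock of `p` is unbounded. -/
def Schedule {n : ℕ} (τ : Fin (n + 1) → ℕ → Prop) (p : Fin (n + 1))
    (c : ℕ → Fin (n + 1) → ℕ) : Prop :=
  (∀ v, c 0 v = 0) ∧ (∀ j, ClockStep τ (c j) (c (j + 1))) ∧ ∀ t, ∃ j, t ≤ c j p

/-- Stage `k` ends at local time `k` of `p`. The clock of `p` therefore advances in each stage,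
which makes the paths between stages nonempty and their infinite concatenation unbounded at `p`.
Other clocks may stop forever. -/
theorem exists_schedule {n : ℕ} {τ : Fin (n + 1) → ℕ → Prop} {p : Fin (n + 1)}
    (Inv : ℕ → (Fin (n + 1) → ℕ) → Prop) (h0 : Inv 0 fun _ => 0)
    (hp : ∀ k c, Inv k c → c p = k)
    (hstep : ∀ k c, Inv k c → ∃ c', ReflTransGen (ClockStep τ) c c' ∧ Inv (k + 1) c') :
    ∃ c, Schedule τ p c := by
  choose! nxt hn using hstep
  let C : ℕ → Fin (n + 1) → ℕ := fun k => Nat.rec (fun _ => 0) (fun k c => nxt k c) k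
  have hC : ∀ k, Inv k (C k) := by
    intro k
    induction k with
    | zero => exact h0
    | succ k ih => exact (hn k _ ih).2
  obtain ⟨f, hf0, hf, hfC⟩ := exists_seq_of_transGen (r := ClockStep τ) (C := C) fun k => by
    rcases reflTransGen_iff_eq_or_transGen.mp (hn k _ (hC k)).1 with h | h
    · have h1 := hp _ _ (hC k)
      have h2 := hp _ _ (hn k _ (hC k)).2
      rw [h] at h2
      omega
    · exact h
  refine ⟨f, fun v => congrFun hf0 v, hf, fun t => ?_⟩
  obtain ⟨j, hj⟩ := hfC t
  exact ⟨j, by rw [hj, hp _ _ (hC t)]⟩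

/-! ### From a large ring to the ring of size two -/

/-- The token cannot leave `b` and come back without visiting `a`. -/
theorem holder_ne_of_not_visited {n : ℕ} {h : ℕ → Fin (n + 1)}
    (hh : ∀ k, h (k + 1) = h k ∨ h (k + 1) = h k + 1) {a b : Fin (n + 1)} {s t : ℕ}
    (hs : h s = b) (hs' : h (s + 1) ≠ b) (hst : s + 1 ≤ t)
    (ha : ∀ j, s + 1 ≤ j → j ≤ t → h j ≠ a) : h t ≠ b := by
  -- The distance `(x - a).val` from `a` along the ring grows with every move that does not reach
  -- `a`, so after leaving `b` it stays above that of `b`.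
  have hsucc : ∀ x : Fin (n + 1), x + 1 ≠ a → (x + 1 - a).val = (x - a).val + 1 := by
    intro x hx
    have e : x + 1 - a = x - a + 1 := by abel
    have h1 : x - a + 1 ≠ 0 := by rw [← e]; exact sub_ne_zero.mpr hx
    rw [e, Fin.val_add_one, if_neg]
    intro h2
    exact h1 (by rw [h2, Fin.last_add_one])
  have key : (b - a).val < (h t - a).val := by
    induction t, hst using Nat.le_induction with
    | base =>
      have e : h (s + 1) = b + 1 := by
        rcases hh s with h1 | h1 <;> rw [hs] at h1
        · exact absurd h1 hs'
        · exact h1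
      have := ha (s + 1) le_rfl le_rfl
      rw [e] at this ⊢
      rw [hsucc _ this]
      exact Nat.lt_succ_self _
    | succ t ht ih =>
      have h1 := ih fun j hj hjt => ha j hj (by omega)
      rcases hh t with h2 | h2
      · rwa [h2]
      · have := ha (t + 1) (by omega) le_rfl
        rw [h2] at this ⊢
        rw [hsucc _ this]
        omega
  intro e
  rw [e] at key
  exact lt_irrefl _ key

/-- Here `p` replays vertex `a` and `r` replays vertex `b`. The clock of `p` makes one tick per
stage, while `r` moves only to meet the next handoff. By `hinf` every sending tick of `p` is
followed by a reception at `b`. -/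
theorem exists_schedule_two {n : ℕ} {h : ℕ → Fin (n + 1)}
    (hh : ∀ k, h (k + 1) = h k ∨ h (k + 1) = h k + 1) {a b : Fin (n + 1)} (hab : a ≠ b)
    (h0 : h 0 = a ∨ h 0 = b) (hinf : ∀ k, ∃ l, k ≤ l ∧ h l = a)
    {τ : Fin (1 + 1) → ℕ → Prop} {p r : Fin (1 + 1)} (hpr : r = p + 1) (hrp : p = r + 1)
    (hne : p ≠ r) (hall : ∀ x, x ≠ p → x = r)
    (hp : ∀ t, τ p t ↔ h t = a) (hr : ∀ t, τ r t ↔ h t = b) :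
    ∃ c, Schedule τ p c := by
  classical
  let V : ℕ → ℕ → Fin (1 + 1) → ℕ := fun k l x => if x = p then k else l
  have Vp : ∀ k l, V k l p = k := fun k l => if_pos rfl
  have Vr : ∀ k l, V k l r = l := fun k l => if_neg hne.symm
  have hV : ∀ c, c = V (c p) (c r) := fun c => funext fun x => by
    by_cases hx : x = p
    · rw [hx, Vp]
    · rw [hall x hx, Vr]
  have advance : ∀ {k l k' l'}, k ≤ k' → l ≤ l' →
      (∀ t, k ≤ t → t < k' → (h t = a ↔ h (t + 1) = a)) →
      (∀ t, l ≤ t → t < l' → (h t = b ↔ h (t + 1) = b)) →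
      ReflTransGen (ClockStep τ) (V k l) (V k' l') := by
    intro k l k' l' hk hl h1 h2
    apply ClockStep.advance
    · intro x
      by_cases hx : x = p
      · simpa only [hx, Vp]
      · simpa only [hall x hx, Vr]
    · intro x t
      by_cases hx : x = p
      · simpa only [hx, Vp, hp] using h1 t
      · simpa only [hall x hx, Vr, hr] using h2 t
  -- If `p` holds the token, `r` lags behind with no visit of `b` left up to time `k`. Otherwise `r`
  -- holds it, and no visit of `a` lies between the two clocks, whichever is ahead.
  refine exists_schedule (fun k c => c p = k ∧
    ((h k = a ∧ c r ≤ k ∧ ∀ j, c r ≤ j → j ≤ k → h j ≠ b) ∨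
      (h (c r) = b ∧ ∀ j, (k ≤ j ∧ j ≤ c r) ∨ (c r ≤ j ∧ j ≤ k) → h j ≠ a)))
    ⟨rfl, ?_⟩ (fun k c hc => hc.1) ?_
  · dsimp only
    rcases h0 with h0 | h0
    · refine .inl ⟨h0, le_rfl, fun j _ hj => ?_⟩
      obtain rfl : j = 0 := by omega
      rwa [h0]
    · refine .inr ⟨h0, fun j hj => ?_⟩
      obtain rfl : j = 0 := by omega
      rw [h0]
      exact hab.symm
  rintro k c ⟨rfl, hc⟩
  generalize hk : c p = k at hc
  generalize hl : c r = l at hc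
  rw [hV c, hk, hl]
  rcases hc with ⟨hka, hlk, hlb⟩ | ⟨hlb, hkl⟩
  · by_cases hka' : h (k + 1) = a
    · refine ⟨V (k + 1) l, advance (by omega) le_rfl (fun t _ _ => ?_) (fun t _ _ => by omega),
        Vp _ _, .inl ⟨hka', by rw [Vr]; omega, fun j hj hjk => ?_⟩⟩
      · obtain rfl : t = k := by omega
        simp [hka, hka']
      · rw [Vr] at hj
        rcases Nat.lt_or_ge k j with hj' | hj'
        · obtain rfl : j = k + 1 := by omega
          rwa [hka']
        · exact hlb j hj hj'
    · have visit : ∀ t, k + 1 ≤ t → h t = a → ∃ u, k + 1 ≤ u ∧ u ≤ t ∧ h u = b := by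
        intro t ht hta
        by_contra! hcon
        exact holder_ne_of_not_visited hh hka hka' ht (fun j hj hjt => hcon j hj hjt) hta
      have hex : ∃ u, k + 1 ≤ u ∧ h u = b := by
        obtain ⟨t, ht, hta⟩ := hinf (k + 1)
        obtain ⟨u, hu, -, hub⟩ := visit t ht hta
        exact ⟨u, hu, hub⟩
      -- The next visit of `b`; with `K` renamed to `K + 1`, `r` idles up to `K` and receives in the
      -- same step in which `p` sends.
      obtain ⟨K, ⟨hK, hKb⟩, hmin⟩ : ∃ u, (k + 1 ≤ u ∧ h u = b) ∧
          ∀ j < u, ¬ (k + 1 ≤ j ∧ h j = b) :=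
        ⟨Nat.find hex, Nat.find_spec hex, fun j => Nat.find_min hex⟩
      obtain ⟨K, rfl⟩ : ∃ K', K = K' + 1 := ⟨K - 1, by omega⟩
      have hnb : ∀ j, l ≤ j → j ≤ K → h j ≠ b := fun j hj hjK e => by
        rcases Nat.lt_or_ge k j with hj' | hj'
        · exact hmin j (by omega) ⟨hj', e⟩
        · exact hlb j hj hj' e
      refine ⟨V (k + 1) (K + 1), ReflTransGen.tail (b := V k K) (advance le_rfl (by omega)
        (fun t _ _ => by omega) (fun t ht htK => ?_)) (.pass p ?_ ?_ ?_ ?_ ?_ ?_ ?_), Vp _ _,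
        .inr ⟨by rwa [Vr], fun j hj e => ?_⟩⟩
      · simp [hnb t ht (by omega), hnb (t + 1) (by omega) (by omega)]
      · rwa [Vp, hp]
      · rwa [Vp, hp]
      · rw [← hpr, Vr, hr]
        exact hnb K (by omega) le_rfl
      · rwa [← hpr, Vr, hr]
      · rw [Vp, Vp]
      · rw [← hpr, Vr, Vr]
      · exact fun x hx hx' => absurd (hall x hx) (hpr ▸ hx')
      · rw [Vr] at hj
        obtain ⟨u, hu, huj, hub⟩ := visit j (by omega) e
        have : ¬ u < K + 1 := fun hlt => hmin u hlt ⟨hu, hub⟩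
        obtain rfl : u = j := by omega
        exact hab (e.symm.trans hub)
  · have hka : h k ≠ a := by
      rcases le_total k l with hle | hle
      · exact hkl k (.inl ⟨le_rfl, hle⟩)
      · exact hkl k (.inr ⟨hle, le_rfl⟩)
    by_cases hka' : h (k + 1) = a
    · have hlk : l ≤ k := by
        by_contra hcon
        exact hkl (k + 1) (.inl ⟨by omega, by omega⟩) hka'
      have hex : ∃ u, l ≤ u ∧ h u ≠ b := ⟨k + 1, by omega, by rwa [hka']⟩
      -- The end of the current visit of `b`. It is no later than `k + 1`; the handoff skips the
      -- token's journey from `b` to `a`.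
      obtain ⟨K, ⟨hK, hKb⟩, hmin⟩ : ∃ u, (l ≤ u ∧ h u ≠ b) ∧ ∀ j < u, ¬ (l ≤ j ∧ h j ≠ b) :=
        ⟨Nat.find hex, Nat.find_spec hex, fun j => Nat.find_min hex⟩
      have hKk : K ≤ k + 1 := by
        by_contra hcon
        exact hmin (k + 1) (by omega) ⟨by omega, by rwa [hka']⟩
      have hKl : K ≠ l := fun e => hKb (e ▸ hlb)
      obtain ⟨K, rfl⟩ : ∃ K', K = K' + 1 := ⟨K - 1, by omega⟩
      have hb : ∀ j, l ≤ j → j ≤ K → h j = b := fun j hj hjK => by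
        by_contra hcon
        exact hmin j (by omega) ⟨hj, hcon⟩
      refine ⟨V (k + 1) (K + 1), ReflTransGen.tail (b := V k K) (advance le_rfl (by omega)
        (fun t _ _ => by omega) (fun t ht htK => ?_)) (.pass r ?_ ?_ ?_ ?_ ?_ ?_ ?_), Vp _ _,
        .inl ⟨hka', by rwa [Vr], fun j hj hjk => ?_⟩⟩
      · simp [hb t ht (by omega), hb (t + 1) (by omega) (by omega)]
      · rw [Vr, hr]
        exact hb K (by omega) le_rfl
      · rwa [Vr, hr]
      · rwa [← hrp, Vp, hp]
      · rwa [← hrp, Vp, hp]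
      · rw [Vr, Vr]
      · rw [← hrp, Vp, Vp]
      · exact fun x hx hx' => absurd (hall x (hrp ▸ hx')) hx
      · rw [Vr] at hj
        rcases Nat.lt_or_ge k j with hj' | hj'
        · obtain rfl : j = k + 1 := by omega
          rwa [hka']
        · exact holder_ne_of_not_visited hh (hb K (by omega) le_rfl) hKb hj
            fun i hi hij => hkl i (.inr ⟨by omega, by omega⟩)
    · refine ⟨V (k + 1) l, advance (by omega) le_rfl (fun t _ _ => ?_) (fun t _ _ => by omega),
        Vp _ _, .inr ⟨by rwa [Vr], fun j hj => ?_⟩⟩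
      · obtain rfl : t = k := by omega
        simp [hka, hka']
      · rw [Vr] at hj
        by_cases hjk : j = k + 1
        · rwa [hjk]
        · exact hkl j (by omega)

/-! ### From the ring of size two to a large ring -/

/-- Vertices `0` and `1` run in lockstep until the token has to return to vertex `0`. Then both wait
at time `k`, and the token makes a full tour within one stage. If it never returns, the remaining
processes just wait forever. -/
theorem exists_schedule_large {m : ℕ} {σ : ℕ → Prop} (hσ : σ 0)
    {τ : Fin (m + 1 + 1) → ℕ → Prop} (h0 : ∀ t, τ 0 t ↔ σ t)
    (h1 : ∀ v t, v ≠ 0 → (τ v t ↔ ¬ σ t)) {p : Fin (m + 1 + 1)} (hp : p = 0 ∨ p = 1) :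
    ∃ c, Schedule τ p c := by
  classical
  have advance : ∀ {c c' : Fin (m + 1 + 1) → ℕ}, (∀ v, c v ≤ c' v) →
      (∀ v t, c v ≤ t → t < c' v → (σ t ↔ σ (t + 1))) → ReflTransGen (ClockStep τ) c c' := by
    intro c c' hle hc
    refine ClockStep.advance hle fun v t ht ht' => ?_
    by_cases hv : v = 0
    · subst hv
      rw [h0, h0, hc 0 t ht ht']
    · rw [h1 v _ hv, h1 v _ hv, hc v t ht ht']
  -- `b` is the last time at which vertex `0` held the token; every vertex other than `0` and `1`
  -- waits there, one tick before its reception.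
  refine exists_schedule (fun k c => c 0 = k ∧ c 1 = k ∧ ((σ k ∧ ∀ v, c v = k) ∨
    (¬ σ k ∧ ∃ b, b < k ∧ σ b ∧ (∀ j, b < j → j ≤ k → ¬ σ j) ∧
      ∀ v, v ≠ 0 → v ≠ 1 → c v = b))) ⟨rfl, rfl, .inl ⟨hσ, fun _ => rfl⟩⟩
    (fun k c hc => by rcases hp with rfl | rfl; exacts [hc.1, hc.2.1]) ?_
  rintro k c ⟨hc0, hc1, ⟨hk, hc⟩ | ⟨hk, b, hbk, hb, hbj, hc⟩⟩
  · by_cases hk' : σ (k + 1)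
    · refine ⟨fun _ => k + 1, advance (fun v => by rw [hc]; omega) (fun v t ht ht' => ?_),
        rfl, rfl, .inl ⟨hk', fun _ => rfl⟩⟩
      rw [hc] at ht
      obtain rfl : t = k := by omega
      simp [hk, hk']
    · refine ⟨fun v => if v = 0 ∨ v = 1 then k + 1 else k,
        .single (.pass 0 ?_ ?_ ?_ ?_ ?_ ?_ ?_), by simp, by simp,
        .inr ⟨hk', k, by omega, hk, fun j hj hj' => ?_, fun v hv hv' => by simp [hv, hv']⟩⟩
      · simpa [h0, hc] using hk
      · simpa [h0, hc] using hk'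
      · simpa [h1, hc] using hk
      · simpa [h1, hc] using hk'
      · simp [hc]
      · simp [hc]
      · exact fun x hx hx' => by
          rw [zero_add] at hx'
          simp [hc, hx, hx']
      · obtain rfl : j = k + 1 := by omega
        exact hk'
  · by_cases hk' : σ (k + 1)
    · let D : ℕ → Fin (m + 1 + 1) → ℕ := fun j v => if v = 0 then k else
        if v.val < j then k + 1 else if v.val = j then k else b
      have hD0 : ∀ j, D j 0 = k := fun j => if_pos rfl
      have hlt : ∀ {j v}, v ≠ 0 → v.val < j → D j v = k + 1 := fun hv h => by simp [D, hv, h]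
      have heq : ∀ {j v}, v ≠ 0 → v.val = j → D j v = k := fun hv h => by simp [D, hv, h]
      have hgt : ∀ {j v}, v ≠ 0 → j < v.val → D j v = b := fun {j v} hv h => by
        simp [D, hv, h.ne', not_lt.mpr h.le]
      have hpos : ∀ {v : Fin (m + 1 + 1)}, v ≠ 0 → 0 < v.val := fun hv =>
        Nat.pos_of_ne_zero fun e => hv (Fin.ext e)
      have hval1 : (1 : Fin (m + 1 + 1)).val = 1 := by simp
      have hchain : ∀ j, j ≤ m → ReflTransGen (ClockStep τ) c (D (j + 1)) := by
        intro j
        induction j with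
        | zero =>
          intro _
          have : c = D 1 := funext fun v => by
            by_cases hv : v = 0
            · rw [hv, hc0, hD0]
            · by_cases hv1 : v = 1
              · rw [heq hv (by rw [hv1, hval1]), hv1, hc1]
              · have := hpos hv
                have h2 : v.val ≠ 1 := fun e => hv1 (Fin.ext (by rw [e, hval1]))
                rw [hgt hv (by omega), hc v hv hv1]
          rw [this]
        | succ j ih =>
          intro hj
          obtain ⟨x, hx⟩ : ∃ x : Fin (m + 1 + 1), x.val = j + 1 := ⟨⟨j + 1, by omega⟩, rfl⟩
          have hx1 : (x + 1).val = j + 1 + 1 := by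
            rw [Fin.val_add_one, if_neg, hx]
            rintro rfl
            simp at hx
            omega
          have hx0 : x ≠ 0 := by rintro rfl; simp at hx
          have hx10 : x + 1 ≠ 0 := fun e => by rw [e] at hx1; simp at hx1
          -- Vertex `x` sends to `x + 1`, which receives at `b` and then runs silently from `b + 1`
          -- to `k`.
          refine (ih (by omega)).trans (ReflTransGen.head
            (b := fun v => if v = x + 1 then b + 1 else D (j + 1 + 1) v)
            (.pass x ?_ ?_ ?_ ?_ ?_ ?_ ?_) (advance (fun v => ?_) fun v t => ?_))
          · rwa [heq hx0 hx, h1 _ _ hx0]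
          · rwa [heq hx0 hx, h1 _ _ hx0, not_not]
          · rwa [hgt hx10 (by omega), h1 _ _ hx10, not_not]
          · rw [hgt hx10 (by omega), h1 _ _ hx10]
            exact hbj _ (by omega) (by omega)
          · rw [heq hx0 hx, if_neg (fun e => by rw [← e] at hx1; omega), hlt hx0 (by rw [hx]; omega)]
          · rw [hgt (j := j + 1) hx10 (by omega), if_pos rfl]
          · intro v hv hv'
            rw [if_neg hv']
            by_cases hv0 : v = 0
            · rw [hv0, hD0, hD0]
            · have h2 : v.val ≠ j + 1 := fun e => hv (Fin.ext (by omega))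
              have h3 : v.val ≠ j + 1 + 1 := fun e => hv' (Fin.ext (by omega))
              rcases Nat.lt_or_ge v.val (j + 1) with h4 | h4
              · rw [hlt hv0 h4, hlt hv0 (by omega)]
              · rw [hgt hv0 (by omega), hgt hv0 (by omega)]
          · split_ifs with hv
            · rw [hv, heq hx10 hx1]
              omega
            · exact le_rfl
          · split_ifs with hv
            · rw [hv, heq hx10 hx1]
              intro ht ht'
              simp [hbj t (by omega) (by omega), hbj (t + 1) (by omega) (by omega)]
            · omega
      have hl : Fin.last (m + 1) + 1 = 0 := Fin.last_add_one _
      have hl0 : Fin.last (m + 1) ≠ 0 := Fin.last_pos.ne'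
      have hlv : (Fin.last (m + 1)).val = m + 1 := rfl
      -- The last vertex sends to vertex `0`, and all clocks agree again.
      refine ⟨fun _ => k + 1, (hchain m le_rfl).tail
        (.pass (Fin.last (m + 1)) ?_ ?_ ?_ ?_ ?_ ?_ ?_), rfl, rfl, .inl ⟨hk', fun _ => rfl⟩⟩
      · rwa [heq hl0 hlv, h1 _ _ hl0]
      · rwa [heq hl0 hlv, h1 _ _ hl0, not_not]
      · rwa [hl, hD0, h0]
      · rwa [hl, hD0, h0]
      · rw [heq hl0 hlv]
      · rw [hl, hD0]
      · intro v hv hv'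
        rw [hl] at hv'
        have := Fin.lt_last_iff_ne_last.mpr hv
        rw [hlt hv' (by omega)]
    · refine ⟨fun v => if v = 0 ∨ v = 1 then k + 1 else b, advance (fun v => ?_)
        (fun v t => ?_), by simp, by simp, .inr ⟨hk', b, by omega, hb, fun j hj hj' => ?_,
        fun v hv hv' => by simp [hv, hv']⟩⟩
      · by_cases hv : v = 0 ∨ v = 1
        · rw [if_pos hv]
          rcases hv with rfl | rfl <;> omega
        · rw [if_neg hv, hc v (fun e => hv (.inl e)) (fun e => hv (.inr e))]
      · by_cases hv : v = 0 ∨ v = 1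
        · rw [if_pos hv]
          intro ht ht'
          obtain rfl : t = k := by rcases hv with rfl | rfl <;> omega
          simp [hk, hk']
        · rw [if_neg hv, hc v (fun e => hv (.inl e)) (fun e => hv (.inr e))]
          omega
      · by_cases hjk : j = k + 1
        · rwa [hjk]
        · exact hbj j hj (by omega)

/-! ### Tracks of single processes -/

section Tracks

variable {Ipr : Type u} {Opr : Type v} {S : Interface Ipr Opr}

/-- The run of a system as seen by a single process, including the positions at which it does
not move. -/
structure Track (P : ProcessTemplate.{u, v, w} S) where
  state : ℕ → P.Q
  inp : ℕ → Set Ipr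
  moved : ℕ → Prop
  trans : ∀ k, moved k → P.trans (state k) (inp k) (state (k + 1))
  stay : ∀ k, ¬ moved k → state (k + 1) = state k
  init : state 0 = P.initT ∨ state 0 = P.initN

namespace Track

variable {P : ProcessTemplate.{u, v, w} S} (T : Track P)

/-- The process has the token at position `k`. -/
def HasTok (k : ℕ) : Prop := S.tok ∈ P.out (T.state k)

/-- Satisfaction of a local formula. -/
def Sat (φ : LocalLTL Ipr Opr) (k : ℕ) : Prop :=
  LTL.Sat (fun k => letter (P.out (T.state k)) (T.inp k)) (fun k => {_u | T.moved k}) φ k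

theorem silent {k : ℕ} (h : T.HasTok k ↔ T.HasTok (k + 1)) (hm : T.moved k) :
    S.snd ∉ P.out (T.state k) ∧ S.rcv ∉ T.inp k := by
  have := P.snd_tok (T.state k)
  have := P.trans_kind _ _ _ (T.trans k hm)
  unfold HasTok at h
  tauto

theorem sends {k : ℕ} (h : T.HasTok k) (h' : ¬ T.HasTok (k + 1)) :
    T.moved k ∧ S.snd ∈ P.out (T.state k) ∧ S.rcv ∉ T.inp k := by
  unfold HasTok at h h'
  by_cases hm : T.moved k
  · have := P.trans_kind _ _ _ (T.trans k hm)
    tauto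
  · rw [T.stay k hm] at h'
    exact absurd h h'

theorem receives {k : ℕ} (h : ¬ T.HasTok k) (h' : T.HasTok (k + 1)) :
    T.moved k ∧ S.snd ∉ P.out (T.state k) ∧ S.rcv ∈ T.inp k := by
  unfold HasTok at h h'
  by_cases hm : T.moved k
  · have := P.snd_tok (T.state k)
    have := P.trans_kind _ _ _ (T.trans k hm)
    tauto
  · rw [T.stay k hm] at h'
    exact absurd h' h

/-- Without infinitely many visits of the token the premise `G F tok` fails. -/
theorem sat_fairSpec {ψ : LocalLTL Ipr Opr}
    (h : (∀ k, ∃ l, k ≤ l ∧ T.HasTok l) → T.Sat (fairSpec S P ψ) 0) :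
    T.Sat (fairSpec S P ψ) 0 := by
  by_cases hinf : ∀ k, ∃ l, k ≤ l ∧ T.HasTok l
  · exact h hinf
  · refine LTL.sat_imp.mpr fun hA => absurd (fun k => ?_) hinf
    obtain ⟨l, hl, hl'⟩ := LTL.sat_ev.mp (LTL.sat_alw.mp hA.2 k (Nat.zero_le k))
    exact ⟨l, hl, by simpa [LTL.Sat, letter, HasTok] using hl'⟩

end Track

variable {n : ℕ} {P : Fin (n + 1) → ProcessTemplate.{u, v, w} S}

theorem step_trans {M : Set (Fin (n + 1))} {s s' : SysState P}
    {inp : Set (SysInVar S (Fin (n + 1)))}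
    (h : InternalStep P M s inp s' ∨ TokenStep P M s inp s') :
    (∀ x ∈ M, (P x).trans (s x) (localIn S inp x) (s' x)) ∧ ∀ x, x ∉ M → s' x = s x := by
  rcases h with ⟨-, h⟩ | ⟨v, -, -, -, -, -, -, h⟩ <;> exact h

/-- The run as seen by the process `v`. -/
def SysSeq.track (x : SysSeq P) (hx : IsRun P x) (v : Fin (n + 1)) : Track (P v) where
  state k := x.state k v
  inp k := localIn S (x.inp k) v
  moved k := v ∈ x.moved k
  trans k := (step_trans (hx.2 k)).1 v
  stay k := (step_trans (hx.2 k)).2 v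
  init := hx.1.1 v

theorem sat_subscript (x : SysSeq P) (hx : IsRun P x) (v : Fin (n + 1)) (φ : LocalLTL Ipr Opr)
    (k : ℕ) : LTL.Sat x.word x.moved (subscript S v φ) k ↔ (x.track hx v).Sat φ k := by
  unfold subscript Track.Sat
  induction φ generalizing k with
  | tru => rfl
  | atom p =>
    rcases p with i | o <;>
      simp [LTL.rename, LTL.Sat, SysSeq.word, letter, SysSeq.track, localIn]
  | neg φ ih => simp only [LTL.rename, LTL.Sat, ih]
  | and φ ψ ih₁ ih₂ => simp only [LTL.rename, LTL.Sat, ih₁, ih₂]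
  | untl φ ψ ih₁ ih₂ => simp only [LTL.rename, LTL.Sat, ih₁, ih₂]
  | next u φ ih =>
    simp only [LTL.rename, LTL.Sat, ih]
    rfl

/-- In a run exactly one process has the token, and it moves along the ring. -/
theorem exists_holder (x : SysSeq P) (hx : IsRun P x)
    (h0 : S.tok ∈ (P 0).out (x.state 0 0)) :
    ∃ h : ℕ → Fin (n + 1), h 0 = 0 ∧ (∀ k, h (k + 1) = h k ∨ h (k + 1) = h k + 1) ∧
      ∀ v k, (x.track hx v).HasTok k ↔ h k = v := by
  have hstep : ∀ k a, (∀ v, S.tok ∈ (P v).out (x.state k v) ↔ a = v) →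
      ∃ b, (b = a ∨ b = a + 1) ∧ ∀ v, S.tok ∈ (P v).out (x.state (k + 1) v) ↔ b = v := by
    intro k a ha
    have hsil : ∀ v, (v ∈ x.moved k → S.snd ∉ (P v).out (x.state k v) ∧
        S.rcv ∉ localIn S (x.inp k) v) →
        (S.tok ∈ (P v).out (x.state (k + 1) v) ↔ S.tok ∈ (P v).out (x.state k v)) := by
      intro v hv
      by_cases hm : v ∈ x.moved k
      · have := (P v).trans_kind _ _ _ ((step_trans (hx.2 k)).1 v hm)
        have := hv hm
        tauto
      · rw [(step_trans (hx.2 k)).2 v hm]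
    rcases hx.2 k with h | ⟨v, hv, hw, hsnd, hsnd', hrcv, hrcv', htr, -⟩
    · exact ⟨a, .inl rfl, fun v => (hsil v (h.1 v)).trans (ha v)⟩
    · obtain rfl : a = v := (ha v).mp ((P v).snd_tok _ hsnd)
      have hw' := (P (a + 1)).trans_kind _ _ _ (htr _ hw)
      -- A receiver cannot already have the token, so it differs from the sender.
      have hne : a ≠ a + 1 := fun e => by
        have h1 := (ha (a + 1)).mpr e
        tauto
      have hv' := (P a).trans_kind _ _ _ (htr _ hv)
      have hva := hrcv' a hv hne
      have ha' := (ha a).mpr rfl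
      refine ⟨a + 1, .inr rfl, fun v => ?_⟩
      by_cases hva' : v = a
      · subst hva'
        have : ¬ v + 1 = v := hne.symm
        tauto
      · by_cases hvw : v = a + 1
        · subst hvw
          tauto
        · rw [hsil v fun hm => ⟨hsnd' v hm hva', hrcv' v hm hvw⟩, ha v]
          exact ⟨fun e => absurd e.symm hva', fun e => absurd e.symm hvw⟩
  choose! nxt hn hn' using hstep
  let h : ℕ → Fin (n + 1) := fun k => Nat.rec 0 (fun k a => nxt k a) k
  have hh : ∀ k v, S.tok ∈ (P v).out (x.state k v) ↔ h k = v := by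
    intro k
    induction k with
    | zero =>
      intro v
      obtain ⟨y, hy, hy'⟩ := hx.1.2
      constructor
      · intro hv
        exact (hy' 0 h0).trans (hy' v hv).symm
      · rintro rfl
        exact h0
    | succ k ih => exact hn' k _ ih
  exact ⟨h, rfl, fun k => hn k _ (hh k), fun v k => hh k v⟩

/-- The system run in which process `v` performs the track `T v` according to the clocks `c`. -/
def assemble (T : ∀ v, Track (P v)) (c : ℕ → Fin (n + 1) → ℕ) : SysSeq P where
  state j v := (T v).state (c j v)
  inp j := {z | ∃ i v, z = inVar S v i ∧ i ∈ (T v).inp (c j v)}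
  moved j := {v | c (j + 1) v ≠ c j v ∧ (T v).moved (c j v)}

/-- Without global inputs no system input variable belongs to two processes, so inputs taken from
unrelated local times never clash. -/
theorem localIn_assemble (hglob : S.glob = ∅) (T : ∀ v, Track (P v))
    (c : ℕ → Fin (n + 1) → ℕ) (j : ℕ) (v : Fin (n + 1)) :
    localIn S ((assemble T c).inp j) v = (T v).inp (c j v) := by
  ext i
  simp only [localIn, assemble, Set.mem_ofPred_eq]
  constructor
  · rintro ⟨i', v', h, hi⟩
    simp only [inVar, hglob, Set.mem_empty_iff_false, dite_false, Sum.inl.injEq,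
      Prod.mk.injEq, Subtype.mk.injEq] at h
    rw [h.1, h.2]
    exact hi
  · exact fun h => ⟨i, v, rfl, h⟩

/-- A silent tick gives an internal step, with nobody moving if the track idles there. In a handoff
only sender and receiver tick, and the change of possession forces `snd` on one and `rcv` on the
other. -/
theorem isRun_assemble (hglob : S.glob = ∅) {T : ∀ v, Track (P v)}
    {c : ℕ → Fin (n + 1) → ℕ} {τ : Fin (n + 1) → ℕ → Prop} (hτ : ∀ v k, τ v k ↔ (T v).HasTok k)
    (hT : ∀ v, (T v).HasTok 0 ↔ v = 0) (hc0 : ∀ v, c 0 v = 0)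
    (hc : ∀ j, ClockStep τ (c j) (c (j + 1))) : IsRun P (assemble T c) := by
  refine ⟨⟨fun v => ?_, 0, ?_, fun v hv => ?_⟩, fun j => ?_⟩
  · simpa only [assemble, hc0] using (T v).init
  · simpa only [assemble, hc0, Track.HasTok] using (hT 0).mpr rfl
  · simp only [assemble, hc0] at hv
    exact (hT v).mp hv
  · have hstay : ∀ v, v ∉ (assemble T c).moved j →
        (c (j + 1) v = c j v ∨ c (j + 1) v = c j v + 1) →
        (assemble T c).state (j + 1) v = (assemble T c).state j v := by
      intro v hv hv'
      rcases hv' with h | h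
      · simp only [assemble, h]
      · simp only [assemble, h]
        exact (T v).stay _ fun hm => hv ⟨by omega, hm⟩
    have htrans : ∀ v ∈ (assemble T c).moved j, c (j + 1) v = c j v + 1 →
        (P v).trans ((assemble T c).state j v) (localIn S ((assemble T c).inp j) v)
          ((assemble T c).state (j + 1) v) := by
      intro v hv h
      rw [localIn_assemble hglob]
      simp only [assemble, h]
      exact (T v).trans _ hv.2
    rcases hc j with ⟨v, hs, hv, ho⟩ | ⟨v, hs, hs', hr, hr', hv, hw, ho⟩
    · left
      have hM : ∀ x ∈ (assemble T c).moved j, x = v := fun x hx => by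
        by_contra h
        exact hx.1 (ho x h)
      refine ⟨fun x hx => ?_, fun x hx => ?_, fun x hx => hstay x hx ?_⟩
      · rw [localIn_assemble hglob]
        obtain rfl := hM x hx
        rw [hτ, hτ] at hs
        exact (T x).silent hs hx.2
      · exact htrans x hx (by rw [hM x hx, hv])
      · by_cases h : x = v
        · rw [h]
          exact .inr hv
        · exact .inl (ho x h)
    · right
      rw [hτ] at hs hs' hr hr'
      obtain ⟨s1, s2, s3⟩ := (T v).sends hs hs'
      obtain ⟨r1, r2, r3⟩ := (T (v + 1)).receives hr hr'
      have hM : ∀ x ∈ (assemble T c).moved j, x = v ∨ x = v + 1 := fun x hx => by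
        by_contra! h
        exact hx.1 (ho x h.1 h.2)
      refine ⟨v, ⟨by omega, s1⟩, ⟨by omega, r1⟩, s2, fun x hx hxv => ?_, ?_,
        fun x hx hxw => ?_, fun x hx => ?_, fun x hx => hstay x hx ?_⟩
      · obtain rfl := (hM x hx).resolve_left hxv
        exact r2
      · rwa [localIn_assemble hglob]
      · rw [localIn_assemble hglob]
        obtain rfl := (hM x hx).resolve_right hxw
        exact s3
      · refine htrans x hx ?_
        rcases hM x hx with rfl | rfl <;> assumption
      · by_cases h : x = v
        · rw [h]
          exact .inr hv
        · by_cases h' : x = v + 1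
          · rw [h']
            exact .inr hw
          · exact .inl (ho x h h')

/-- What `p` sees of the assembled run is its own track read through its clock, so
`LTL.sat_comp_clock` applies. -/
theorem sat_assemble (hglob : S.glob = ∅) {T : ∀ v, Track (P v)}
    {c : ℕ → Fin (n + 1) → ℕ} {τ : Fin (n + 1) → ℕ → Prop} {p : Fin (n + 1)}
    (hc : Schedule τ p c) (hrun : IsRun P (assemble T c)) (φ : LocalLTL Ipr Opr) :
    ((assemble T c).track hrun p).Sat φ 0 ↔ (T p).Sat φ 0 := by
  have hadv : ∀ j, c (j + 1) p = c j p ∨ c (j + 1) p = c j p + 1 := by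
    intro j
    rcases hc.2.1 j with ⟨v, -, hv, ho⟩ | ⟨v, -, -, -, -, hv, hw, ho⟩
    · by_cases h : p = v
      · rw [h]
        exact .inr hv
      · exact .inl (ho p h)
    · by_cases h : p = v
      · rw [h]
        exact .inr hv
      · by_cases h' : p = v + 1
        · rw [h']
          exact .inr hw
        · exact .inl (ho p h h')
  have key := LTL.sat_comp_clock (w := fun k => letter ((P p).out ((T p).state k)) ((T p).inp k))
    (M := fun k => {_u : Unit | (T p).moved k})
    (M' := fun j => {_u : Unit | p ∈ (assemble T c).moved j}) (c := fun j => c j p)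
    hadv hc.2.2 (fun j v => Iff.rfl) φ 0
  simp only [hc.1] at key
  unfold Track.Sat
  rw [← key]
  simp only [SysSeq.track, localIn_assemble hglob]
  rfl

/-- Tracks along a schedule give a run whose process `p` satisfies the same formulas as its
track. -/
theorem exists_run (hglob : S.glob = ∅) (T : ∀ v, Track (P v))
    (hT : ∀ v, (T v).HasTok 0 ↔ v = 0) {p : Fin (n + 1)}
    (hc : ∃ c, Schedule (fun v k => (T v).HasTok k) p c) :
    ∃ (y : SysSeq P) (hy : IsRun P y), S.tok ∈ (P 0).out (y.state 0 0) ∧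
      ∀ φ, (y.track hy p).Sat φ 0 ↔ (T p).Sat φ 0 := by
  obtain ⟨c, hc⟩ := hc
  have hrun := isRun_assemble hglob (fun _ _ => Iff.rfl) hT hc.1 hc.2.1
  refine ⟨assemble T c, hrun, ?_, sat_assemble hglob hc hrun⟩
  simp only [assemble, hc.1]
  exact (hT 0).mpr rfl

end Tracks

/-! ### Transfer of runs between ring sizes -/

section Cutoff

variable {Ipr : Type u} {Opr : Type v} {S : Interface Ipr Opr} {A B : ProcessTemplate.{u, v, w} S}

/-- The tracks for the ring of size `m + 1` in which all `B`-processes perform the same track. -/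
def ringTracks (TA : Track A) (TB : Track B) (m : ℕ) : ∀ v, Track (ring A B m v) :=
  Fin.cases TA fun _ => TB

theorem models_subscript_iff {n : ℕ} {φ : LocalLTL Ipr Opr} {p : Fin (n + 1)} :
    Models A B n (subscript S p φ) ↔ ∀ (x : SysSeq (ring A B n)) (hx : IsRun (ring A B n) x),
      S.tok ∈ (ring A B n 0).out (x.state 0 0) → (x.track hx p).Sat φ 0 :=
  ⟨fun h x hx h0 => (sat_subscript x hx p φ 0).mp (h x hx h0),
    fun h x hx h0 => (sat_subscript x hx p φ 0).mpr (h x hx h0)⟩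

theorem models_specB_iff {n : ℕ} {ψ : LocalLTL Ipr Opr} :
    Models A B n (specB S B ψ n) ↔
      ∀ i : Fin n, Models A B n (subscript S i.succ (fairSpec S B ψ)) := by
  simp only [Models, specB, LTL.sat_conj, List.mem_map, List.mem_finRange, true_and,
    forall_exists_index, forall_apply_eq_imp_iff]
  exact ⟨fun h i x hx h0 => h x hx h0 i, fun h x hx h0 i => h i x hx h0⟩

/-- A run of a large ring yields runs of the ring of size two, for the `A`-process and for
any `B`-process. -/
theorem exists_run_two (hglob : S.glob = ∅) {n : ℕ} (x : SysSeq (ring A B n))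
    (hx : IsRun (ring A B n) x) (h0 : S.tok ∈ (ring A B n 0).out (x.state 0 0)) (i : Fin n) :
    ((∀ k, ∃ l, k ≤ l ∧ (x.track hx 0).HasTok l) →
      ∃ (y : SysSeq (ring A B 1)) (hy : IsRun (ring A B 1) y),
        S.tok ∈ (ring A B 1 0).out (y.state 0 0) ∧
        ∀ φ, (y.track hy 0).Sat φ 0 ↔ (x.track hx 0).Sat φ 0) ∧
    ((∀ k, ∃ l, k ≤ l ∧ (x.track hx i.succ).HasTok l) →
      ∃ (y : SysSeq (ring A B 1)) (hy : IsRun (ring A B 1) y),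
        S.tok ∈ (ring A B 1 0).out (y.state 0 0) ∧
        ∀ φ, (y.track hy 1).Sat φ 0 ↔ (x.track hx i.succ).Sat φ 0) := by
  obtain ⟨h, hh0, hh, hτ⟩ := exists_holder x hx h0
  let T : ∀ v, Track (ring A B 1 v) := ringTracks (x.track hx 0) (x.track hx i.succ) 1
  have hT0 : ∀ t, (T 0).HasTok t ↔ h t = 0 := hτ 0
  have hT1 : ∀ t, (T 1).HasTok t ↔ h t = i.succ := hτ i.succ
  have hT : ∀ v, (T v).HasTok 0 ↔ v = 0 := by
    rw [Fin.forall_fin_two, hT0, hT1, hh0]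
    simp [(Fin.succ_ne_zero i).symm]
  constructor
  · intro hinf
    refine exists_run hglob T hT (p := 0) (exists_schedule_two hh (Fin.succ_ne_zero i).symm
      (.inl hh0) (fun k => ?_) (r := 1) rfl rfl (by decide) (by decide) hT0 hT1)
    simpa only [hτ] using hinf k
  · intro hinf
    refine exists_run hglob T hT (p := 1) (exists_schedule_two hh (Fin.succ_ne_zero i)
      (.inr hh0) (fun k => ?_) (r := 0) rfl rfl (by decide) (by decide) hT1 hT0)
    simpa only [hτ] using hinf k

/-- A run of the ring of size two yields runs of a large ring, for the `A`-process and for the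
first `B`-process. -/
theorem exists_run_large (hglob : S.glob = ∅) (m : ℕ) (x : SysSeq (ring A B 1))
    (hx : IsRun (ring A B 1) x) (h0 : S.tok ∈ (ring A B 1 0).out (x.state 0 0)) :
    (∃ (y : SysSeq (ring A B (m + 1))) (hy : IsRun (ring A B (m + 1)) y),
        S.tok ∈ (ring A B (m + 1) 0).out (y.state 0 0) ∧
        ∀ φ, (y.track hy 0).Sat φ 0 ↔ (x.track hx 0).Sat φ 0) ∧
    (∃ (y : SysSeq (ring A B (m + 1))) (hy : IsRun (ring A B (m + 1)) y),
        S.tok ∈ (ring A B (m + 1) 0).out (y.state 0 0) ∧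
        ∀ φ, (y.track hy (Fin.succ 0)).Sat φ 0 ↔ (x.track hx 1).Sat φ 0) := by
  obtain ⟨h, hh0, -, hτ⟩ := exists_holder x hx h0
  let T : ∀ v, Track (ring A B (m + 1) v) := ringTracks (x.track hx 0) (x.track hx 1) (m + 1)
  have hT0 : ∀ t, (T 0).HasTok t ↔ h t = 0 := hτ 0
  have hT1 : ∀ v t, v ≠ 0 → ((T v).HasTok t ↔ ¬ h t = 0) := by
    intro v t hv
    obtain ⟨i, rfl⟩ := Fin.exists_succ_eq.mpr hv
    refine (hτ 1 t).trans ?_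
    generalize h t = a
    revert a
    decide
  have hT : ∀ v, (T v).HasTok 0 ↔ v = 0 := by
    intro v
    by_cases hv : v = 0
    · subst hv
      simp [hT0, hh0]
    · simp [hT1 v 0 hv, hh0, hv]
  exact ⟨exists_run hglob T hT (p := 0) (exists_schedule_large hh0 hT0 hT1 (.inl rfl)),
    exists_run hglob T hT (p := Fin.succ 0) (exists_schedule_large hh0 hT0 hT1 (.inr rfl))⟩

end Cutoff

end TokenRing

theorem mainTheorem11 {Ipr : Type*} {Opr : Type*} (S : TokenRing.Interface Ipr Opr)
    (hglob : S.glob = ∅) (A B : TokenRing.ProcessTemplate S)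
    (ψ : TokenRing.LocalLTL Ipr Opr) :
    TokenRing.IsCutoff A B (TokenRing.specA S A ψ) 1 ∧
    TokenRing.IsCutoff A B (TokenRing.specB S B ψ) 1 := by
  open TokenRing in
  refine ⟨fun n hn => ?_, fun n hn => ?_⟩
  · simp only [specA, models_subscript_iff]
    constructor
    · intro h x hx h0
      refine Track.sat_fairSpec (P := A) _ fun hinf => ?_
      obtain ⟨y, hy, hy0, hsat⟩ := (exists_run_two hglob x hx h0 ⟨0, hn⟩).1 hinf
      exact (hsat _).mp (h y hy hy0)
    · intro h x hx h0
      obtain ⟨m, rfl⟩ : ∃ m, n = m + 1 := ⟨n - 1, by omega⟩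
      obtain ⟨y, hy, hy0, hsat⟩ := (exists_run_large hglob m x hx h0).1
      exact (hsat _).mp (h y hy hy0)
  · simp only [models_specB_iff, models_subscript_iff]
    constructor
    · intro h i x hx h0
      refine Track.sat_fairSpec (P := B) _ fun hinf => ?_
      obtain ⟨y, hy, hy0, hsat⟩ := (exists_run_two hglob x hx h0 i).2 hinf
      exact (hsat _).mp (h 0 y hy hy0)
    · intro h i x hx h0
      obtain ⟨m, rfl⟩ : ∃ m, n = m + 1 := ⟨n - 1, by omega⟩
      obtain rfl : i = 0 := Subsingleton.elim _ _
      obtain ⟨y, hy, hy0, hsat⟩ := (exists_run_large hglob m x hx h0).2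
      exact (hsat _).mp (h 0 y hy hy0)
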